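/- **Lemma 2.3 (Weak Comparison Principle).** Let $(\Omega,\mathcal F,\mathbf P)$ be a probability space and let $H:\mathbf R^d\times\mathbf R^d\times\Omega\to\mathbf R$, $H=H(p,y,\omega)$, satisfy: - **(A1)** (stationary ergodicity) there is a group $\{\tau_y\}_{y\in\mathbf R^d}$ of measurable, measure-preserving transformations of $\Omega$ with $\tau_{x+y}=\tau_x\circ\tau_y$, such that every $A\in\mathcal F$ with $\tau_z(A)=A$ for all $z\in\mathbf R^d$ has $\mathbf P[A]\in\{0,1\}$, and $H(p,y,\tau_z\omega)=H(p,y+z,\omega)$ for all $p,y,z,\omega$; - **(A2)** (level-set convexity) $H(\frac{p+q}{2},y,\omega)\le\max\{H(p,y,\omega),H(q,y,\omega)\}$ for all $p,q,y,\omega$; - **(A3)** (coercivity) $\lim_{|p|\to\infty}\operatorname{ess\,inf}_{(y,\omega)\in\mathbf R^d\times\Omega}H(p,y,\omega)=+\infty$; - **(A4)** for every $R>0$ the family $\{H(\cdot,\cdot,\omega):\omega\in\Omega\}$ is uniformly bounded and uniformly equicontinuous on $B_R\times\mathbf R^d$. Let $\mathcal S$ be the set of globally Lipschitz $w:\mathbf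 R^d\to\mathbf R$ with $\lim_{|y|\to\infty}w(y)/|y|=0$, and put $$\widehat H(p)=\widehat H(p,\omega):=\inf_{w\in\mathcal S}\ \operatorname*{ess\,sup}_{y\in\mathbf R^d}H(p+Dw(y),y,\omega).$$ Then for $\mathbf P$-almost every $\omega\in\Omega$ the following holds (with $\omega$ suppressed) for all $p\in\mathbf R^d$, all real $\mu,\nu$ and every nonempty compact $K\subset\mathbf R^d$. Assume $\widehat H(p)<\mu<\nu$, and let $u,v:\mathbf R^d\to\mathbf R$ be such that $u$ and $-v$ are upper semicontinuous, $$H(p+Du,y)\le\mu\quad\text{and}\quad H(p+Dv,y)\ge\nu\qquad\text{in }\mathbf R^d\setminus K$$ in the viscosity sense (for every $\varphi\in C^\infty(\mathbf R^d)$ and $x\in\mathbf R^d\setminus K$: if $u-\varphi$ has a local maximum at $x$, then $H(p+D\varphi(x),x)\le\mu$; if $v-\varphi$ has a local minimum at $x$, then $H(p+D\varphi(x),x)\ge\nu$), and $$\liminf_{|y|\to\infty}\frac{v(y)}{|y|}\ge 0.$$ Then $u-v$ attains a maximum over $K$, and $$\sup_{\mathbf R^d}(u-v)=\max_K(u-v).$$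 -/

import Mathlib

open MeasureTheory Filter Topology Set

noncomputable section

namespace HJ

/-- Physical space `ℝ^d` with its Euclidean norm. -/
abbrev Space (d : ℕ) : Type := EuclideanSpace ℝ (Fin d)

/-- Stationary ergodicity of the random Hamiltonian `H(p, y, ω)` with respect to a group
`τ` of measure-preserving transformations of the probability space. -/
structure StationaryErgodic {d : ℕ} {Ω : Type*} [MeasurableSpace Ω] (P : Measure Ω)
    (τ : Space d → Ω → Ω) (H : Space d → Space d → Ω → ℝ) : Prop where
  map_zero : τ 0 = id
  map_add : ∀ x y : Space d, τ (x + y) = τ x ∘ τ y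
  measurePreserving : ∀ y : Space d, MeasurePreserving (τ y) P P
  ergodic : ∀ A : Set Ω, MeasurableSet A → (∀ z : Space d, τ z '' A = A) → P A = 0 ∨ P A = 1
  stationary : ∀ (p y z : Space d) (ω : Ω), H p y (τ z ω) = H p (y + z) ω

/-- Level-set convexity in the gradient variable. -/
def LevelSetConvex {d : ℕ} {Ω : Type*} (H : Space d → Space d → Ω → ℝ) : Prop :=
  ∀ (y : Space d) (ω : Ω) (p q : Space d),
    H ((1 / 2 : ℝ) • (p + q)) y ω ≤ max (H p y ω) (H q y ω)

/-- Coercivity: `ess inf_{(y, ω)} H(p, y, ω) → +∞` as `|p| → ∞`. The essential infimum is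
taken in the extended reals. -/
def Coercive {d : ℕ} {Ω : Type*} [MeasurableSpace Ω] (P : Measure Ω)
    (H : Space d → Space d → Ω → ℝ) : Prop :=
  Tendsto
    (fun p : Space d =>
      essInf (fun z : Space d × Ω => ((H p z.1 z.2 : ℝ) : EReal))
        ((volume : Measure (Space d)).prod P))
    (Bornology.cobounded (Space d)) (𝓝 (⊤ : EReal))

/-- For every `R > 0` the family `{H(·, ·, ω) : ω ∈ Ω}` is (uniformly) bounded and (uniformly)
equicontinuous on `B_R × ℝ^d`. -/
def BoundedEquicontinuous {d : ℕ} {Ω : Type*} (H : Space d → Space d → Ω → ℝ) : Prop :=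
  ∀ R : ℝ, 0 < R →
    (∃ C : ℝ, ∀ ω : Ω, ∀ p ∈ Metric.ball (0 : Space d) R, ∀ y : Space d, |H p y ω| ≤ C) ∧
    UniformEquicontinuousOn (fun (ω : Ω) (z : Space d × Space d) => H z.1 z.2 ω)
      (Metric.ball (0 : Space d) R ×ˢ univ)

/-- The class `𝒮` of real-valued globally Lipschitz functions on `ℝ^d` that are strictly
sublinear at infinity. -/
def sublinearLipschitz (d : ℕ) : Set (Space d → ℝ) :=
  {w | (∃ C : NNReal, LipschitzWith C w) ∧
    Tendsto (fun y : Space d => w y / ‖y‖) (Bornology.cobounded (Space d)) (𝓝 0)}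

/-- `Ĥ(p) = inf_{w ∈ 𝒮} ess sup_y H(p + Dw(y), y)` for a fixed realization
`h = H(·, ·, ω)`, as an extended real number. A Lipschitz `w` is differentiable almost
everywhere, so the value of `gradient w` elsewhere plays no role. -/
def Hhat {d : ℕ} (h : Space d → Space d → ℝ) (p : Space d) : EReal :=
  ⨅ w ∈ sublinearLipschitz d,
    essSup (fun y : Space d => ((h (p + gradient w y) y : ℝ) : EReal)) volume

/-- `u` satisfies `h(p + Du, y) ≤ μ` in the open set `U` in the viscosity sense. -/
def IsViscositySubsolution {d : ℕ} (h : Space d → Space d → ℝ) (p : Space d) (μ : ℝ)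
    (U : Set (Space d)) (u : Space d → ℝ) : Prop :=
  ∀ φ : Space d → ℝ, ContDiff ℝ (⊤ : ℕ∞) φ → ∀ x ∈ U,
    IsLocalMax (fun y => u y - φ y) x → h (p + gradient φ x) x ≤ μ

/-- `v` satisfies `h(p + Dv, y) ≥ ν` in the open set `U` in the viscosity sense. -/
def IsViscositySupersolution {d : ℕ} (h : Space d → Space d → ℝ) (p : Space d) (ν : ℝ)
    (U : Set (Space d)) (v : Space d → ℝ) : Prop :=
  ∀ φ : Space d → ℝ, ContDiff ℝ (⊤ : ℕ∞) φ → ∀ x ∈ U,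
    IsLocalMin (fun y => v y - φ y) x → ν ≤ h (p + gradient φ x) x

end HJ

end

noncomputable section

namespace HJ

variable {d : ℕ}

/-! For almost every realization `h`, sublevel sets in the gradient variable are convex and bounded
uniformly in `y`, and `h` is uniformly continuous (`ae_regular`); the rest is deterministic. The
obstacle is that `u` has no growth bound, so `u - v` need not attain a maximum. The hypothesis on
`Hhat` supplies a sublinear Lipschitz `w` that is an a.e. subsolution on the whole space. Averaging
it (`exists_differentiable_subsolution`) and subtracting `ε√(1 + |y|²)` gives a classical
subsolution `W`, at a level still below `ν`, with `W - v → -∞`.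

Replace `u` by `θ = W + softMin R (u - W)`. Its formal gradient is a convex combination of `Du` and
`DW`, so level-set convexity keeps it a subsolution outside `K`. Since `θ < W + R`, the difference
`θ - v` attains a global maximum, which doubling of variables (`not_isMax_sub_supersolution`) forces
into `K`. As `θ ≤ u`, this gives `θ - v ≤ max_K (u - v)` for every `R`; let `R → ∞`. -/

theorem hasGradientAt_of_hasFDerivAt {f : Space d → ℝ} {f' : Space d →L[ℝ] ℝ} {q x : Space d}
    (h : HasFDerivAt f f' x) (hq : ∀ y, f' y = inner ℝ q y) : HasGradientAt f q x := by
  rw [hasGradientAt_iff_hasFDerivAt]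
  convert! h using 1
  ext y
  simp [hq]

/-! ### Regularity of almost every realization -/

/-- A midpoint-closed closed set is convex. -/
theorem convex_of_isClosed_of_midpoint {E : Type*} [NormedAddCommGroup E] [NormedSpace ℝ E]
    {s : Set E} (hs : IsClosed s) (hmid : ∀ x ∈ s, ∀ y ∈ s, (1 / 2 : ℝ) • (x + y) ∈ s) :
    Convex ℝ s := by
  rw [convex_iff_segment_subset]
  intro x hx y hy z hz
  rw [segment_eq_image_lineMap] at hz
  obtain ⟨t, ht, rfl⟩ := hz
  set g : ℝ → E := fun r => AffineMap.lineMap x y r with hg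
  have hgc : Continuous g := AffineMap.lineMap_continuous
  set T : Set ℝ := g ⁻¹' s
  have hT : IsClosed T := hs.preimage hgc
  have hTm : ∀ a ∈ T, ∀ b ∈ T, (a + b) / 2 ∈ T := by
    intro a ha b hb
    have := hmid _ ha _ hb
    have e : g ((a + b) / 2) = (1 / 2 : ℝ) • (g a + g b) := by
      simp only [hg, AffineMap.lineMap_apply_module]
      module
    change g ((a + b) / 2) ∈ s
    rwa [e]
  have h0 : (0 : ℝ) ∈ T := by change g 0 ∈ s; simpa [hg] using hx
  have h1 : (1 : ℝ) ∈ T := by change g 1 ∈ s; simpa [hg] using hy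
  by_contra hnot
  have hnT : t ∉ T := hnot
  have hA : IsCompact (T ∩ Icc 0 t) := isCompact_Icc.inter_left hT
  have hB : IsCompact (T ∩ Icc t 1) := isCompact_Icc.inter_left hT
  -- `(a, b)` is the gap of `T` around `t`; its midpoint would lie in `T`.
  obtain ⟨a, ⟨haT, ha⟩, hamax⟩ := hA.exists_isGreatest ⟨0, h0, le_refl _, ht.1⟩
  obtain ⟨b, ⟨hbT, hb⟩, hbmin⟩ := hB.exists_isLeast ⟨1, h1, ht.2, le_refl _⟩
  have hat : a < t := lt_of_le_of_ne ha.2 fun h => hnT (h ▸ haT)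
  have htb : t < b := lt_of_le_of_ne hb.1 fun h => hnT (h ▸ hbT)
  have hm := hTm a haT b hbT
  rcases le_total ((a + b) / 2) t with h | h
  · have := hamax ⟨hm, by linarith [ha.1], h⟩
    linarith
  · have := hbmin ⟨hm, h, by linarith [hb.2]⟩
    linarith

/-- The properties of a single realization of the Hamiltonian used in the comparison argument. -/
structure Regular (h : Space d → Space d → ℝ) : Prop where
  uniform : ∀ R : ℝ, 0 < R → ∀ ε : ℝ, 0 < ε → ∃ δ > 0, ∀ q ∈ Metric.ball (0 : Space d) R,
    ∀ q' ∈ Metric.ball (0 : Space d) R, ∀ x x' : Space d,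
      dist q q' < δ → dist x x' < δ → |h q x - h q' x'| < ε
  convex : ∀ (y : Space d) (c : ℝ), Convex ℝ {q | h q y ≤ c}
  coercive : ∀ c : ℝ, ∃ R : ℝ, ∀ q y : Space d, h q y ≤ c → ‖q‖ ≤ R

theorem continuous_of_uniform {h : Space d → Space d → ℝ}
    (hu : ∀ R : ℝ, 0 < R → ∀ ε : ℝ, 0 < ε → ∃ δ > 0, ∀ q ∈ Metric.ball (0 : Space d) R,
      ∀ q' ∈ Metric.ball (0 : Space d) R, ∀ x x' : Space d,
        dist q q' < δ → dist x x' < δ → |h q x - h q' x'| < ε) :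
    Continuous fun z : Space d × Space d => h z.1 z.2 := by
  rw [Metric.continuous_iff]
  rintro ⟨q, x⟩ ε hε
  obtain ⟨δ, hδ, H⟩ := hu (‖q‖ + 1) (by positivity) ε hε
  refine ⟨min δ 1, by positivity, ?_⟩
  rintro ⟨q', x'⟩ hz
  rw [Prod.dist_eq, max_lt_iff, lt_min_iff, lt_min_iff] at hz
  obtain ⟨⟨h1, h2⟩, h3, h4⟩ := hz
  refine H q' ?_ q ?_ x' x h1 h3
  · rw [mem_ball_zero_iff]
    have : ‖q'‖ ≤ ‖q‖ + dist q' q := by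
      rw [dist_eq_norm]; simpa [add_comm] using norm_add_le q (q' - q)
    simp only at h2
    linarith
  · rw [mem_ball_zero_iff]; linarith

theorem Regular.continuous {h : Space d → Space d → ℝ} (hr : Regular h) :
    Continuous fun z : Space d × Space d => h z.1 z.2 :=
  continuous_of_uniform hr.uniform

theorem BoundedEquicontinuous.uniform {Ω : Type*} {H : Space d → Space d → Ω → ℝ}
    (hH : BoundedEquicontinuous H) (ω : Ω) : ∀ R : ℝ, 0 < R → ∀ ε : ℝ, 0 < ε → ∃ δ > 0,
      ∀ q ∈ Metric.ball (0 : Space d) R, ∀ q' ∈ Metric.ball (0 : Space d) R, ∀ x x' : Space d,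
        dist q q' < δ → dist x x' < δ → |H q x ω - H q' x' ω| < ε := by
  intro R hR ε hε
  have h1 := (hH R hR).2.uniformContinuousOn ω
  rw [Metric.uniformContinuousOn_iff] at h1
  obtain ⟨δ, hδ, h2⟩ := h1 ε hε
  refine ⟨δ, hδ, fun q hq q' hq' x x' hqq hxx => ?_⟩
  have := h2 (q, x) ⟨hq, mem_univ _⟩ (q', x') ⟨hq', mem_univ _⟩
    (by rw [Prod.dist_eq]; exact max_lt hqq hxx)
  simpa [Real.dist_eq] using this

/-- Coercivity holds uniformly in the space variable for almost every realization. -/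
theorem Coercive.ae_forall {Ω : Type*} [MeasurableSpace Ω] {P : Measure Ω} [IsProbabilityMeasure P]
    {H : Space d → Space d → Ω → ℝ} (hc : Coercive P H)
    (hcont : ∀ ω, Continuous fun z : Space d × Space d => H z.1 z.2 ω) :
    ∀ᵐ ω ∂P, ∀ c : ℝ, ∃ R : ℝ, ∀ q y : Space d, H q y ω ≤ c → ‖q‖ ≤ R := by
  have h1 : ∀ n : ℕ, ∃ R : ℝ, ∀ q : Space d, R < ‖q‖ →
      ∀ᵐ z ∂((volume : Measure (Space d)).prod P), (n : ℝ) < H q z.1 z.2 := by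
    intro n
    have h2 := hc.eventually (lt_mem_nhds (EReal.coe_lt_top (n : ℝ)))
    obtain ⟨R, -, hR⟩ := (Filter.hasBasis_cobounded_norm (E := Space d)).eventually_iff.1 h2
    refine ⟨R, fun q hq => ?_⟩
    have h3 := hR hq.le
    filter_upwards [ae_lt_of_lt_essInf h3] with z hz
    exact_mod_cast hz
  choose R hR using h1
  -- The exceptional null set depends on `q`, so only countably many `q` are used; continuity in
  -- `y`, then in `q`, recovers the rest.
  obtain ⟨D, hDc, hDd⟩ := TopologicalSpace.exists_countable_dense (Space d)
  have h4 : ∀ᵐ ω ∂P, ∀ n : ℕ, ∀ q ∈ D, R n < ‖q‖ → ∀ᵐ y : Space d, (n : ℝ) < H q y ω := by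
    rw [ae_all_iff]
    intro n
    rw [ae_ball_iff hDc]
    intro q _
    by_cases hq : R n < ‖q‖
    · have h5 := (Measure.measurePreserving_swap (μ := P)
        (ν := (volume : Measure (Space d)))).quasiMeasurePreserving.ae (hR n q hq)
      filter_upwards [Measure.ae_ae_of_ae_prod h5] with ω hω _
      exact hω
    · exact ae_of_all _ fun ω h => absurd h hq
  filter_upwards [h4] with ω hω c
  obtain ⟨n, hn⟩ := exists_nat_gt c
  refine ⟨R n, fun q y hqy => ?_⟩
  by_contra! hlt
  have hopen : IsOpen {q : Space d | R n < ‖q‖} := isOpen_lt continuous_const continuous_norm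
  have hcl : IsClosed {q : Space d | (n : ℝ) ≤ H q y ω} :=
    isClosed_le continuous_const ((hcont ω).comp (by fun_prop : Continuous fun q => (q, y)))
  have hsub : {q : Space d | R n < ‖q‖} ∩ D ⊆ {q | (n : ℝ) ≤ H q y ω} := by
    rintro q' ⟨hq', hq'D⟩
    have hd : Dense {y : Space d | (n : ℝ) < H q' y ω} :=
      Measure.dense_of_ae (hω n q' hq'D hq')
    have hcl' : IsClosed {y : Space d | (n : ℝ) ≤ H q' y ω} :=
      isClosed_le continuous_const ((hcont ω).comp (by fun_prop : Continuous fun y => (q', y)))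
    have : closure {y : Space d | (n : ℝ) < H q' y ω} ⊆ {y : Space d | (n : ℝ) ≤ H q' y ω} :=
      closure_minimal (fun y h => (show (n : ℝ) < H q' y ω from h).le) hcl'
    exact this (hd y)
  have := closure_minimal hsub hcl (hDd.open_subset_closure_inter hopen hlt)
  have h6 : (n : ℝ) ≤ H q y ω := this
  linarith

/-- Continuity closes the sublevel sets, so midpoint convexity becomes convexity for every `ω`; only
coercivity costs a null set. -/
theorem ae_regular {Ω : Type*} [MeasurableSpace Ω] {P : Measure Ω} [IsProbabilityMeasure P]
    {H : Space d → Space d → Ω → ℝ} (hA2 : LevelSetConvex H) (hA3 : Coercive P H)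
    (hA4 : BoundedEquicontinuous H) : ∀ᵐ ω ∂P, Regular fun q y => H q y ω := by
  have hcont : ∀ ω, Continuous fun z : Space d × Space d => H z.1 z.2 ω :=
    fun ω => continuous_of_uniform (hA4.uniform ω)
  filter_upwards [hA3.ae_forall hcont] with ω hω
  refine ⟨hA4.uniform ω, fun y c => ?_, hω⟩
  refine convex_of_isClosed_of_midpoint (isClosed_le
    ((hcont ω).comp (by fun_prop : Continuous fun q => (q, y))) continuous_const) ?_
  intro q hq q' hq'
  exact (hA2 y ω q q').trans (max_le hq hq')

/-! ### Gradient calculus -/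

theorem hasGradientAt_norm_sub_sq (a x : Space d) (k : ℝ) :
    HasGradientAt (fun y => k * ‖y - a‖ ^ 2) ((2 * k) • (x - a)) x := by
  have h : HasFDerivAt (fun y : Space d => ‖y - a‖ ^ 2) _ x :=
    ((hasFDerivAt_id x).sub_const a).norm_sq
  refine hasGradientAt_of_hasFDerivAt (h.const_mul k) fun y => ?_
  simp [inner_smul_left, inner_sub_left]
  ring

theorem hasGradientAt_inner (q x : Space d) :
    HasGradientAt (fun y => inner ℝ q y) q x := by
  refine hasGradientAt_of_hasFDerivAt (innerSL ℝ q).hasFDerivAt fun y => ?_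
  simp

theorem hasGradientAt_add {f g : Space d → ℝ} {a b x : Space d} (hf : HasGradientAt f a x)
    (hg : HasGradientAt g b x) : HasGradientAt (fun y => f y + g y) (a + b) x := by
  refine hasGradientAt_of_hasFDerivAt (hf.hasFDerivAt.add hg.hasFDerivAt) fun y => ?_
  simp [inner_add_left]

theorem hasGradientAt_comp {f : Space d → ℝ} {g : ℝ → ℝ} {g' : ℝ} {a x : Space d}
    (hg : HasDerivAt g g' (f x)) (hf : HasGradientAt f a x) :
    HasGradientAt (fun y => g (f y)) (g' • a) x := by
  refine hasGradientAt_of_hasFDerivAt (hg.comp_hasFDerivAt x hf.hasFDerivAt) fun y => ?_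
  simp [inner_smul_left]

theorem hasGradientAt_const_mul {f : Space d → ℝ} {a x : Space d} (c : ℝ)
    (hf : HasGradientAt f a x) : HasGradientAt (fun y => c * f y) (c • a) x :=
  hasGradientAt_comp (g := fun t => c * t) (by simpa using (hasDerivAt_id (f x)).const_mul c) hf

/-! ### Viscosity tests and doubling of variables -/

/-- A viscosity subsolution may be tested with functions that are merely differentiable at the
contact point. -/
theorem IsViscositySubsolution.le_of_hasGradientAt {h : Space d → Space d → ℝ}
    (hcont : Continuous fun z : Space d × Space d => h z.1 z.2) {p : Space d} {μ : ℝ}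
    {U : Set (Space d)} (hU : IsOpen U) {u : Space d → ℝ} (hu : UpperSemicontinuous u)
    (hsub : IsViscositySubsolution h p μ U u) {ψ : Space d → ℝ} {q x : Space d} (hx : x ∈ U)
    (hψ : HasGradientAt ψ q x) (hmax : IsLocalMax (fun y => u y - ψ y) x) :
    h (p + q) x ≤ μ := by
  by_contra! hlt
  have hcont' : Continuous fun z : Space d × Space d => h (p + z.1) z.2 :=
    hcont.comp (by fun_prop : Continuous fun z : Space d × Space d => (p + z.1, z.2))
  have hev : ∀ᶠ z in 𝓝 (q, x), μ < h (p + z.1) z.2 :=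
    hcont'.continuousAt.eventually (lt_mem_nhds hlt)
  obtain ⟨δ, hδ, hδh⟩ := Metric.eventually_nhds_iff.1 hev
  set s : ℝ := δ / 4 with hs
  have hs0 : 0 < s := by positivity
  have ho : ∀ᶠ y in 𝓝 x, ψ y - ψ x - inner ℝ q (y - x) ≤ s / 2 * ‖y - x‖ := by
    have := (hasGradientAt_iff_isLittleO.1 hψ).bound (by positivity : 0 < s / 2)
    filter_upwards [this] with y hy
    exact (le_abs_self _).trans hy
  obtain ⟨r₀, hr₀, hr⟩ := Metric.eventually_nhds_iff.1 ((ho.and hmax).and (hU.mem_nhds hx))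
  set r : ℝ := min (r₀ / 2) (δ / 2) with hrdef
  have hr0 : 0 < r := by positivity
  have hrr₀ : r < r₀ := (min_le_left _ _).trans_lt (by linarith)
  have hrδ : r < δ := (min_le_right _ _).trans_lt (by linarith)
  -- On the sphere of radius `r` the penalty `s * r` beats the first-order error `s * r / 2`, so the
  -- maximum over the ball is interior. There the gradient of `φ` differs from `q` by at most `2 * s
  -- = δ / 2`.
  set φ : Space d → ℝ := fun y => inner ℝ q y + s / r * ‖y - x‖ ^ 2 with hφ
  have hφc : ContDiff ℝ (⊤ : ℕ∞) φ := by
    refine ContDiff.add (innerSL ℝ q).contDiff (contDiff_const.mul ?_)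
    exact (contDiff_id.sub contDiff_const).norm_sq ℝ
  have husc : UpperSemicontinuous fun y => u y - φ y := by
    simp only [sub_eq_add_neg]
    exact hu.add hφc.continuous.neg.upperSemicontinuous
  obtain ⟨z, hz, hzmax⟩ := (husc.upperSemicontinuousOn _).exists_isMaxOn
    ⟨x, Metric.mem_closedBall_self hr0.le⟩ (isCompact_closedBall x r)
  have hzx : u x - φ x ≤ u z - φ z := hzmax (Metric.mem_closedBall_self hr0.le)
  have hzr : dist z x < r := by
    refine lt_of_le_of_ne hz fun heq => ?_
    obtain ⟨⟨h1, h2⟩, -⟩ := hr (heq ▸ hrr₀)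
    have hn : ‖z - x‖ = r := by rw [← dist_eq_norm]; exact heq
    have h3 : s / r * r ^ 2 = s * r := by field_simp
    have h4 : 0 < s * r := by positivity
    simp only [hφ, sub_self, norm_zero, hn, h3] at hzx
    rw [hn, inner_sub_right] at h1
    simp only at h2
    have h5 : s / r * 0 ^ 2 = 0 := by simp
    rw [h5] at hzx
    linarith
  have hloc : IsLocalMax (fun y => u y - φ y) z :=
    hzmax.isLocalMax (mem_of_superset (Metric.isOpen_ball.mem_nhds hzr) Metric.ball_subset_closedBall)
  have hzU : z ∈ U := (hr (hzr.trans hrr₀)).2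
  have hgrad : HasGradientAt φ (q + (2 * (s / r)) • (z - x)) z :=
    hasGradientAt_add (hasGradientAt_inner q z) (hasGradientAt_norm_sub_sq x z (s / r))
  have hle := hsub φ hφc z hzU hloc
  rw [hgrad.gradient] at hle
  have hlt' : μ < h (p + (q + (2 * (s / r)) • (z - x))) z := by
    refine hδh (y := (q + (2 * (s / r)) • (z - x), z)) ?_
    rw [Prod.dist_eq]
    refine max_lt ?_ (hzr.trans hrδ)
    simp only [dist_eq_norm, add_sub_cancel_left, norm_smul, Real.norm_eq_abs]
    rw [abs_of_pos (by positivity), ← dist_eq_norm]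
    calc 2 * (s / r) * dist z x ≤ 2 * (s / r) * r := by gcongr
      _ = δ / 2 := by rw [hs]; field_simp; ring
      _ < δ := by linarith
  linarith

/-- Doubling of variables: a function whose superdifferentials lie in the sublevel sets of `h` at
level `μ` cannot touch a supersolution at a level `ν > μ` from below. -/
theorem not_isMax_sub_supersolution {h : Space d → Space d → ℝ} (hr : Regular h) {p : Space d}
    {μ ν : ℝ} (hμν : μ < ν) {U : Set (Space d)} (hU : IsOpen U) {θ v : Space d → ℝ}
    (hθ : UpperSemicontinuous θ) (hv : UpperSemicontinuous fun y => -v y)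
    (hsub : ∀ (φ : Space d → ℝ) (q x : Space d), x ∈ U → HasGradientAt φ q x →
      IsLocalMax (fun y => θ y - φ y) x → h (p + q) x ≤ μ)
    (hsup : IsViscositySupersolution h p ν U v) {x₀ : Space d} (hx₀ : x₀ ∈ U)
    (hmax : ∀ y, θ y - v y ≤ θ x₀ - v x₀) : False := by
  obtain ⟨r, hr0, hrU⟩ := Metric.nhds_basis_closedBall.mem_iff.1 (hU.mem_nhds hx₀)
  set B : Set (Space d × Space d) := Metric.closedBall x₀ r ×ˢ Metric.closedBall x₀ r with hB
  have hBc : IsCompact B := (isCompact_closedBall x₀ r).prod (isCompact_closedBall x₀ r)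
  have hx₀B : (x₀, x₀) ∈ B := ⟨Metric.mem_closedBall_self hr0.le, Metric.mem_closedBall_self hr0.le⟩
  have husc : UpperSemicontinuous fun z : Space d × Space d => θ z.1 - v z.2 := by
    simp only [sub_eq_add_neg]
    exact (hθ.comp continuous_fst).add (hv.comp continuous_snd)
  obtain ⟨C, hC⟩ := (husc.upperSemicontinuousOn B).bddAbove_of_isCompact hBc
  have hC' : ∀ z ∈ B, θ z.1 - v z.2 ≤ C := fun z hz => hC (mem_image_of_mem _ hz)
  -- The maximum at `x₀` need not be strict; the term `‖z.1 - x₀‖ ^ 2` forces the maximizers to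
  -- converge to `x₀`.
  set Φ : ℕ → Space d × Space d → ℝ := fun n z =>
    θ z.1 - v z.2 - ((n : ℝ) * ‖z.1 - z.2‖ ^ 2 + ‖z.1 - x₀‖ ^ 2) with hΦ
  have hΦmax : ∀ n, ∃ z ∈ B, IsMaxOn (Φ n) B z := by
    intro n
    refine UpperSemicontinuousOn.exists_isMaxOn ⟨_, hx₀B⟩ hBc
      (UpperSemicontinuous.upperSemicontinuousOn ?_ _)
    have hcts : Continuous fun z : Space d × Space d =>
      -((n : ℝ) * ‖z.1 - z.2‖ ^ 2 + ‖z.1 - x₀‖ ^ 2) := by fun_prop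
    have := husc.add hcts.upperSemicontinuous
    simpa only [hΦ, sub_eq_add_neg] using this
  choose z hzB hzmax using hΦmax
  set m : ℝ := θ x₀ - v x₀ with hm
  have hge : ∀ n : ℕ, m + ((n : ℝ) * ‖(z n).1 - (z n).2‖ ^ 2 + ‖(z n).1 - x₀‖ ^ 2) ≤
      θ (z n).1 - v (z n).2 := by
    intro n
    have h1 : Φ n (x₀, x₀) ≤ Φ n (z n) := hzmax n hx₀B
    simp only [hΦ, sub_self, norm_zero] at h1
    have h2 : (n : ℝ) * 0 ^ 2 + (0 : ℝ) ^ 2 = 0 := by simp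
    rw [h2] at h1
    linarith
  obtain ⟨a, -, σ, hσ, hlim⟩ := hBc.tendsto_subseq hzB
  have hσt := hσ.tendsto_atTop
  have hlim1 : Tendsto (fun k => (z (σ k)).1) atTop (𝓝 a.1) :=
    (continuous_fst.tendsto a).comp hlim
  have hlim2 : Tendsto (fun k => (z (σ k)).2) atTop (𝓝 a.2) :=
    (continuous_snd.tendsto a).comp hlim
  have hdiff : Tendsto (fun k => ‖(z (σ k)).1 - (z (σ k)).2‖ ^ 2) atTop (𝓝 0) := by
    have hn : Tendsto (fun k => (C - m) / ((σ k : ℕ) : ℝ)) atTop (𝓝 0) :=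
      (tendsto_const_div_atTop_nhds_zero_nat (C - m)).comp hσt
    refine squeeze_zero' (Eventually.of_forall fun k => by positivity) ?_ hn
    filter_upwards [hσt.eventually_gt_atTop 0] with k hk
    have hk' : (0 : ℝ) < (σ k : ℝ) := by exact_mod_cast hk
    rw [le_div_iff₀ hk']
    have := hge (σ k)
    have := hC' _ (hzB (σ k))
    nlinarith [sq_nonneg ‖(z (σ k)).1 - x₀‖]
  have ha12 : a.1 = a.2 := by
    have h1 := tendsto_nhds_unique hdiff ((hlim1.sub hlim2).norm.pow 2)
    have h2 : ‖a.1 - a.2‖ = 0 := by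
      have := h1.symm
      exact pow_eq_zero_iff (two_ne_zero) |>.1 this
    exact sub_eq_zero.1 (norm_eq_zero.1 h2)
  have ha1 : a.1 = x₀ := by
    have h1 : ∀ ε : ℝ, 0 < ε → ‖a.1 - x₀‖ ^ 2 ≤ ε := by
      intro ε hε
      have h2 : ∀ᶠ w in 𝓝 a, θ w.1 - v w.2 < m + ε := by
        refine upperSemicontinuousAt_iff.1 (husc.upperSemicontinuousAt a) _ ?_
        have := hmax a.1
        rw [← ha12]
        linarith
      refine le_of_tendsto ((hlim1.sub_const x₀).norm.pow 2) ?_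
      filter_upwards [hlim.eventually h2] with k hk
      have := hge (σ k)
      have : 0 ≤ ((σ k : ℕ) : ℝ) * ‖(z (σ k)).1 - (z (σ k)).2‖ ^ 2 := by positivity
      simp only [Function.comp] at hk
      linarith
    have h2 : ‖a.1 - x₀‖ ^ 2 ≤ 0 := le_of_forall_pos_le_add fun ε hε => by
      simpa using h1 ε hε
    have h3 : ‖a.1 - x₀‖ = 0 := pow_eq_zero_iff two_ne_zero |>.1 (le_antisymm h2 (by positivity))
    exact sub_eq_zero.1 (norm_eq_zero.1 h3)
  rw [ha1] at hlim1 ha12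
  rw [← ha12] at hlim2
  -- Coercivity bounds the gradients `2n(x - y)` independently of `n`, so one modulus of continuity
  -- serves. The extra `2` in the radius absorbs `2 * dist x x₀ < 2`, the gap between the two
  -- gradients.
  obtain ⟨R, hR⟩ := hr.coercive μ
  obtain ⟨δ, hδ, huni⟩ := hr.uniform (max R 0 + 2) (by positivity) (ν - μ) (sub_pos.2 hμν)
  have hδ' : 0 < min (min r 1) (δ / 2) := by positivity
  obtain ⟨k, hk1, hk2⟩ := ((hlim1.eventually (Metric.ball_mem_nhds x₀ hδ')).and
    (hlim2.eventually (Metric.ball_mem_nhds x₀ hδ'))).exists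
  set n := σ k
  set x := (z n).1 with hxdef
  set y := (z n).2 with hydef
  rw [lt_min_iff, lt_min_iff] at hk1 hk2
  obtain ⟨⟨hx1, hx2⟩, hx3⟩ := hk1
  obtain ⟨⟨hy1, -⟩, hy3⟩ := hk2
  have hxB : Metric.closedBall x₀ r ∈ 𝓝 x :=
    mem_of_superset (Metric.isOpen_ball.mem_nhds hx1) Metric.ball_subset_closedBall
  have hyB : Metric.closedBall x₀ r ∈ 𝓝 y :=
    mem_of_superset (Metric.isOpen_ball.mem_nhds hy1) Metric.ball_subset_closedBall
  have hmx : h (p + ((2 * (n : ℝ)) • (x - y) + (2 * (1 : ℝ)) • (x - x₀))) x ≤ μ := by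
    refine hsub (fun w => n * ‖w - y‖ ^ 2 + 1 * ‖w - x₀‖ ^ 2) _ x (hrU hx1.le)
      (hasGradientAt_add (hasGradientAt_norm_sub_sq y x n) (hasGradientAt_norm_sub_sq x₀ x 1)) ?_
    filter_upwards [hxB] with w hw
    have h1 : Φ n (w, y) ≤ Φ n (z n) := hzmax n ⟨hw, (hzB n).2⟩
    simp only [hΦ] at h1
    change θ w - (n * ‖w - y‖ ^ 2 + 1 * ‖w - x₀‖ ^ 2) ≤
      θ x - (n * ‖x - y‖ ^ 2 + 1 * ‖x - x₀‖ ^ 2)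
    linarith
  have hmy : ν ≤ h (p + (2 * (n : ℝ)) • (x - y)) y := by
    have hgr := hasGradientAt_norm_sub_sq x y (-(n : ℝ))
    have h2 := hsup (fun w => -(n : ℝ) * ‖w - x‖ ^ 2)
      (contDiff_const.mul ((contDiff_id.sub contDiff_const).norm_sq ℝ)) y (hrU hy1.le) ?_
    · rw [hgr.gradient] at h2
      have e : (2 * -(n : ℝ)) • (y - x) = (2 * (n : ℝ)) • (x - y) := by module
      rwa [e] at h2
    · filter_upwards [hyB] with w hw
      have h1 : Φ n (x, w) ≤ Φ n (z n) := hzmax n ⟨(hzB n).1, hw⟩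
      simp only [hΦ] at h1
      rw [norm_sub_rev w x, norm_sub_rev y x]
      change v y - -(n : ℝ) * ‖x - y‖ ^ 2 ≤ v w - -(n : ℝ) * ‖x - w‖ ^ 2
      linarith
  have hnorm := hR _ _ hmx
  set Q := p + ((2 * (n : ℝ)) • (x - y) + (2 * (1 : ℝ)) • (x - x₀)) with hQ
  set Q' := p + (2 * (n : ℝ)) • (x - y) with hQ'
  have hQQ : dist Q Q' = 2 * dist x x₀ := by
    rw [dist_eq_norm, dist_eq_norm, hQ, hQ', ← add_assoc, add_sub_cancel_left, norm_smul]
    simp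
  have hQ'n : ‖Q'‖ ≤ ‖Q‖ + dist Q Q' := by
    rw [dist_comm, dist_eq_norm]; simpa using norm_add_le Q (Q' - Q)
  have hfin := huni Q (by rw [mem_ball_zero_iff]; linarith [le_max_left R 0]) Q'
    (by rw [mem_ball_zero_iff]; linarith [le_max_left R 0]) x y (by linarith)
    (by linarith [dist_triangle_right x y x₀])
  have := neg_abs_le (h Q x - h Q' y)
  linarith

/-! ### Averaging an almost everywhere subsolution -/

theorem norm_gradient (f : Space d → ℝ) (x : Space d) : ‖gradient f x‖ = ‖fderiv ℝ f x‖ := by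
  rw [gradient, LinearIsometryEquiv.norm_map]

theorem measurable_gradient (f : Space d → ℝ) : Measurable (gradient f) :=
  (InnerProductSpace.toDual ℝ (Space d)).symm.continuous.measurable.comp (measurable_fderiv ℝ f)

/-- Averaging an almost everywhere Lipschitz subsolution over small balls yields an everywhere
differentiable classical subsolution at a slightly higher level. -/
theorem exists_differentiable_subsolution {h : Space d → Space d → ℝ} (hr : Regular h)
    {p : Space d} {c η : ℝ} (hη : 0 < η) {w : Space d → ℝ} {L : NNReal} (hL : LipschitzWith L w)
    (hw : ∀ᵐ y, h (p + gradient w y) y ≤ c) :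
    ∃ (W : Space d → ℝ) (DW : Space d → Space d), (∀ x, HasGradientAt W (DW x) x) ∧
      (∀ x, ‖DW x‖ ≤ L) ∧ (∀ x, |W x - w x| ≤ L) ∧ ∀ x, h (p + DW x) x ≤ c + η := by
  obtain ⟨δ', hδ', huni⟩ := hr.uniform (‖p‖ + L + 1) (by positivity) η hη
  -- The cap `1` keeps the average within `L` of `w`.
  set δ : ℝ := min δ' 1 with hδ
  have hδ0 : 0 < δ := by positivity
  have hball : (volume : Measure (Space d)) (Metric.ball 0 δ) ≠ 0 :=
    (Metric.measure_ball_pos volume 0 hδ0).ne'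
  set m : Measure (Space d) := ProbabilityTheory.cond volume (Metric.ball 0 δ) with hm
  have : IsProbabilityMeasure m :=
    ProbabilityTheory.cond_isProbabilityMeasure_of_finite hball measure_ball_lt_top.ne
  have hac : m ≪ volume := ProbabilityTheory.cond_absolutelyContinuous
  have hmem : ∀ᵐ z ∂m, z ∈ Metric.ball (0 : Space d) δ :=
    ProbabilityTheory.ae_cond_mem Metric.isOpen_ball.measurableSet
  have hlip : ∀ x y, |w x - w y| ≤ L * ‖x - y‖ := fun x y => by
    simpa [Real.dist_eq, dist_eq_norm] using hL.dist_le_mul x y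
  have hgl : ∀ y, ‖gradient w y‖ ≤ L := fun y => by
    rw [norm_gradient]; exact norm_fderiv_le_of_lipschitz ℝ hL
  have hshift : ∀ (x : Space d) {q : Space d → Prop}, (∀ᵐ y, q y) → ∀ᵐ z ∂m, q (x - z) :=
    fun x q hq => hac.ae_le
      ((quasiMeasurePreserving_sub_left (volume : Measure (Space d)) x).ae hq)
  have hint : ∀ x, Integrable (fun z => w (x - z)) m := fun x => by
    refine Integrable.of_bound
      (hL.continuous.comp (continuous_const.sub continuous_id)).aestronglyMeasurable
      (|w x| + L * δ) ?_
    filter_upwards [hmem] with z hz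
    rw [mem_ball_zero_iff] at hz
    have h1 := hlip (x - z) x
    have h2 : ‖x - z - x‖ = ‖z‖ := by simp
    rw [h2] at h1
    have h3 : (L : ℝ) * ‖z‖ ≤ L * δ := by gcongr
    have h4 := abs_sub_abs_le_abs_sub (w (x - z)) (w x)
    rw [Real.norm_eq_abs]
    linarith
  have hgint : ∀ x, Integrable (fun z => gradient w (x - z)) m := fun x =>
    Integrable.of_bound ((measurable_gradient w).comp
      (measurable_const.sub measurable_id)).aestronglyMeasurable L (ae_of_all _ fun z => hgl _)
  -- With `x` frozen, each shifted gradient lies in a fixed closed convex set, up to the error `η`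
  -- from the shift; hence so does the average.
  have hmain : ∀ x, (∫ z, gradient w (x - z) ∂m) ∈
      Metric.closedBall (0 : Space d) L ∩ {q | h (p + q) x ≤ c + η} := by
    intro x
    refine Convex.integral_mem ?_ ?_ ?_ (hgint x)
    · exact (convex_closedBall _ _).inter ((hr.convex x (c + η)).translate_preimage_right p)
    · exact Metric.isClosed_closedBall.inter (isClosed_le (hr.continuous.comp
        (by fun_prop : Continuous fun q : Space d => (p + q, x))) continuous_const)
    · filter_upwards [hshift x hw, hmem] with z hz hzδ
      refine ⟨by simpa using hgl (x - z), ?_⟩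
      have hb : p + gradient w (x - z) ∈ Metric.ball (0 : Space d) (‖p‖ + L + 1) := by
        rw [mem_ball_zero_iff]
        linarith [norm_add_le p (gradient w (x - z)), hgl (x - z)]
      have := huni _ hb _ hb x (x - z) (by simpa using hδ') (by
        rw [mem_ball_zero_iff] at hzδ
        simpa [dist_eq_norm] using hzδ.trans_le (min_le_left _ _))
      have := le_abs_self (h (p + gradient w (x - z)) x - h (p + gradient w (x - z)) (x - z))
      change h (p + gradient w (x - z)) x ≤ c + η
      linarith
  refine ⟨fun x => ∫ z, w (x - z) ∂m, fun x => ∫ z, gradient w (x - z) ∂m, fun x => ?_,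
    fun x => by simpa using (hmain x).1, fun x => ?_, fun x => (hmain x).2⟩
  -- For each `x`, `w` is differentiable at `x - z` for almost every `z`, by Rademacher; so the
  -- average is differentiable at every point.
  · obtain ⟨h1, h2⟩ := hasFDerivAt_integral_of_dominated_loc_of_lip' (𝕜 := ℝ) (μ := m)
      (F := fun x z => w (x - z)) (F' := fun z => fderiv ℝ w (x - z)) (x₀ := x)
      (bound := fun _ => (L : ℝ)) (s := univ) univ_mem (fun y _ => (hint y).1) (hint x)
      (((measurable_fderiv ℝ w).comp
        (measurable_const.sub measurable_id)).aestronglyMeasurable)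
      (ae_of_all _ fun z y _ => by
        have := hlip (y - z) (x - z)
        simpa using this)
      (integrable_const _) (by
        filter_upwards [hshift x hL.ae_differentiableAt] with z hz
        have h3 := hz.hasFDerivAt
        simpa [Function.comp_def] using h3.comp x ((hasFDerivAt_id x).sub_const z))
    refine hasGradientAt_of_hasFDerivAt h2 fun y => ?_
    rw [ContinuousLinearMap.integral_apply h1, real_inner_comm, ← integral_inner (hgint x)]
    refine integral_congr_ae (ae_of_all _ fun z => ?_)
    simp
  · have h1 : (∫ z, w (x - z) ∂m) - w x = ∫ z, (w (x - z) - w x) ∂m := by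
      rw [integral_sub (hint x) (integrable_const _)]; simp
    have h2 := norm_integral_le_of_norm_le_const (μ := m) (f := fun z => w (x - z) - w x)
      (C := L) (by
        filter_upwards [hmem] with z hz
        rw [mem_ball_zero_iff] at hz
        have h3 := hlip (x - z) x
        have h4 : ‖x - z - x‖ = ‖z‖ := by simp
        rw [h4] at h3
        refine h3.trans ?_
        have : ‖z‖ ≤ 1 := hz.le.trans (min_le_right _ _)
        exact mul_le_of_le_one_right L.coe_nonneg this)
    simp only [h1]
    simpa using h2

/-! ### Penalization and truncation -/

/-- The gradient of `y ↦ √(1 + |y|²)` has norm at most one. -/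
theorem exists_hasGradientAt_sqrt_one_add_sq (x : Space d) :
    ∃ q : Space d, ‖q‖ ≤ 1 ∧ HasGradientAt (fun y => √(1 + ‖y‖ ^ 2)) q x := by
  have h1 : HasGradientAt (fun y : Space d => ‖y‖ ^ 2) ((2 : ℝ) • x) x := by
    simpa using hasGradientAt_norm_sub_sq 0 x 1
  have hpos : 0 < 1 + ‖x‖ ^ 2 := by positivity
  have h2 : HasDerivAt (fun t : ℝ => √(1 + t)) (1 / (2 * √(1 + ‖x‖ ^ 2))) (‖x‖ ^ 2) :=
    ((hasDerivAt_id (‖x‖ ^ 2)).const_add 1).sqrt hpos.ne'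
  refine ⟨_, ?_, hasGradientAt_comp (g := fun t => √(1 + t)) h2 h1⟩
  rw [smul_smul, norm_smul, Real.norm_eq_abs, abs_of_nonneg (by positivity)]
  have h3 : ‖x‖ ≤ √(1 + ‖x‖ ^ 2) := Real.le_sqrt_of_sq_le (by linarith)
  have h4 : 0 < √(1 + ‖x‖ ^ 2) := Real.sqrt_pos.2 hpos
  have h5 : 1 / (2 * √(1 + ‖x‖ ^ 2)) * 2 * ‖x‖ = ‖x‖ / √(1 + ‖x‖ ^ 2) := by field_simp
  rw [h5]
  exact div_le_one_of_le₀ h3 h4.le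

/-- A smooth increasing concave truncation of the identity at height `R`. -/
def softMin (R t : ℝ) : ℝ := t - Real.log (1 + Real.exp (t - R))

/-- Equivalently `e^{-softMin} = e^{-t} + e^{-R}`: the bound by `R`, monotonicity and the explicit
inverse can all be read off. -/
theorem exp_sub_softMin (R t : ℝ) :
    Real.exp (R - softMin R t) = Real.exp (R - t) + 1 := by
  have h : R - softMin R t = (R - t) + Real.log (1 + Real.exp (t - R)) := by
    unfold softMin; ring
  rw [h, Real.exp_add, Real.exp_log (by positivity), mul_add, ← Real.exp_add]
  simp

theorem softMin_lt (R t : ℝ) : softMin R t < R := by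
  have h : Real.exp 0 < Real.exp (R - softMin R t) := by
    rw [exp_sub_softMin, Real.exp_zero]
    linarith [Real.exp_pos (R - t)]
  linarith [Real.exp_lt_exp.1 h]

theorem softMin_le (R t : ℝ) : softMin R t ≤ t := by
  have : 0 ≤ Real.log (1 + Real.exp (t - R)) :=
    Real.log_nonneg (by linarith [Real.exp_pos (t - R)])
  unfold softMin
  linarith

theorem continuous_softMin (R : ℝ) : Continuous (softMin R) := by
  unfold softMin
  exact continuous_id.sub (Continuous.log (by fun_prop) fun t => by positivity)

theorem monotone_softMin (R : ℝ) : Monotone (softMin R) := by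
  intro s t hst
  have h : Real.exp (R - softMin R t) ≤ Real.exp (R - softMin R s) := by
    rw [exp_sub_softMin, exp_sub_softMin]
    gcongr
  linarith [Real.exp_le_exp.1 h]

theorem tendsto_softMin (t : ℝ) : Tendsto (fun R => softMin R t) atTop (𝓝 t) := by
  have h1 : Tendsto (fun R : ℝ => Real.exp (t - R)) atTop (𝓝 0) :=
    Real.tendsto_exp_atBot.comp (tendsto_atBot_add_const_left _ t tendsto_neg_atTop_atBot)
  have h2 : Tendsto (fun R : ℝ => Real.log (1 + Real.exp (t - R))) atTop (𝓝 (Real.log (1 + 0))) :=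
    (h1.const_add 1).log (by norm_num)
  simpa [softMin] using h2.const_sub t

/-- If `W` is a classical subsolution and `u` a viscosity subsolution, the smooth truncation
`W + softMin R (u - W)` is again a subsolution. -/
theorem IsViscositySubsolution.softMin_le_of_hasGradientAt {h : Space d → Space d → ℝ}
    (hr : Regular h) {p : Space d} {μ c : ℝ} (hμc : μ ≤ c) {U : Set (Space d)} (hU : IsOpen U)
    {u W : Space d → ℝ} (hu : UpperSemicontinuous u) (hsub : IsViscositySubsolution h p μ U u)
    {DW : Space d → Space d} (hW : ∀ x, HasGradientAt W (DW x) x)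
    (hWc : ∀ x, h (p + DW x) x ≤ c) (R : ℝ) {φ : Space d → ℝ} {q x : Space d} (hx : x ∈ U)
    (hφ : HasGradientAt φ q x)
    (hmax : IsLocalMax (fun y => W y + softMin R (u y - W y) - φ y) x) :
    h (p + q) x ≤ c := by
  set s₀ : ℝ := softMin R (u x - W x) with hs₀
  -- Near `x`, `ζ` touches `softMin R (u - W)` from above; applying the inverse `G` below makes `W +
  -- G ∘ ζ` touch `u` from above.
  set ζ : Space d → ℝ := fun y => φ y + ((-1) * W y + (W x + s₀ - φ x)) with hζ
  have hζx : ζ x = s₀ := by simp only [hζ]; ring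
  have hζg : HasGradientAt ζ (q + ((-1 : ℝ) • DW x + 0)) x :=
    hasGradientAt_add hφ (hasGradientAt_add (hasGradientAt_const_mul (-1) (hW x))
      (hasGradientAt_const x _))
  set e : ℝ := Real.exp (R - s₀) with he
  have he1 : 1 < e := by
    rw [he, hs₀, exp_sub_softMin]
    linarith [Real.exp_pos (R - (u x - W x))]
  set G : ℝ → ℝ := fun s => R - Real.log (Real.exp (R - s) - 1) with hG
  have hGs : ∀ t, G (softMin R t) = t := fun t => by
    simp only [hG, exp_sub_softMin, add_sub_cancel_right, Real.log_exp, sub_sub_cancel]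
  have hGd : HasDerivAt G (e / (e - 1)) (ζ x) := by
    rw [hζx]
    have h1 : HasDerivAt (fun s : ℝ => Real.exp (R - s) - 1) (-e) s₀ := by
      simpa using (((hasDerivAt_id s₀).const_sub R).exp).sub_const 1
    have h2 := (h1.log (sub_pos.2 he1).ne').const_sub R
    convert! h2 using 1
    rw [neg_div, neg_neg]
  have hψ := hasGradientAt_add (hW x) (hasGradientAt_comp hGd hζg)
  have hloc : IsLocalMax (fun y => u y - (W y + G (ζ y))) x := by
    have hζlt : ∀ᶠ y in 𝓝 x, ζ y < R :=
      hζg.differentiableAt.continuousAt.eventually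
        (gt_mem_nhds (by rw [hζx]; exact softMin_lt _ _))
    filter_upwards [hmax, hζlt] with y hy hyR
    have h0 : u x - (W x + G (ζ x)) = 0 := by
      rw [hζx, hs₀, hGs]; ring
    rw [h0]
    have h1 : softMin R (u y - W y) ≤ ζ y := by
      simp only [hζ]
      linarith
    have h2 : G (softMin R (u y - W y)) ≤ G (ζ y) := by
      have h3 : 0 < Real.exp (R - ζ y) - 1 := by
        have := Real.add_one_lt_exp (sub_pos.2 hyR).ne'
        linarith
      have h4 : Real.exp (R - ζ y) ≤ Real.exp (R - softMin R (u y - W y)) := by gcongr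
      have h5 := Real.log_le_log h3 (sub_le_sub_right h4 1)
      simp only [hG]
      linarith
    rw [hGs] at h2
    linarith
  -- This test function is known only to be differentiable at `x`, as `W` and `φ` are, hence the
  -- enlarged test class.
  have hle := (hsub.le_of_hasGradientAt hr.continuous hU hu hx hψ hloc).trans hμc
  have hκ : 0 < e - 1 := sub_pos.2 he1
  -- The weight `(e - 1) / e` is the slope of `softMin R` at `u x - W x`.
  have hcomb := hr.convex x c hle (hWc x) (a := (e - 1) / e) (b := 1 / e) (by positivity)
    (by positivity) (by field_simp; ring)
  have heq : ((e - 1) / e) • (p + (DW x + (e / (e - 1)) • (q + ((-1 : ℝ) • DW x + 0)))) +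
      (1 / e) • (p + DW x) = p + q := by
    have h1 : (e - 1) / e * (e / (e - 1)) = 1 := by field_simp
    have h2 : (e - 1) / e = 1 - 1 / e := by field_simp
    rw [smul_add, smul_add, smul_smul, h1, h2]
    module
  rw [heq] at hcomb
  exact hcomb

/-! ### Comparison -/

/-- An upper semicontinuous function tending to `-∞` at infinity attains its maximum. -/
theorem exists_forall_le_of_tendsto_atBot {F : Space d → ℝ} (hF : UpperSemicontinuous F)
    (hlim : Tendsto F (Bornology.cobounded (Space d)) atBot) : ∃ x, ∀ y, F y ≤ F x := by
  have h1 := hlim.eventually (eventually_le_atBot (F 0))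
  obtain ⟨r, -, hr⟩ := (Filter.hasBasis_cobounded_norm (E := Space d)).eventually_iff.1 h1
  have h0 : (0 : Space d) ∈ Metric.closedBall (0 : Space d) (max r 0) := by simp
  obtain ⟨x, -, hx⟩ := (hF.upperSemicontinuousOn _).exists_isMaxOn ⟨0, h0⟩
    (isCompact_closedBall (0 : Space d) (max r 0))
  refine ⟨x, fun y => ?_⟩
  by_cases hy : y ∈ Metric.closedBall (0 : Space d) (max r 0)
  · exact hx hy
  · rw [mem_closedBall_zero_iff, not_le] at hy
    exact (hr ((le_max_left r 0).trans hy.le)).trans (hx h0)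

/-- Comparison in an exterior domain for a fixed realization of the Hamiltonian. -/
theorem Regular.comparison {h : Space d → Space d → ℝ} (hr : Regular h) {p : Space d} {μ ν : ℝ}
    {K : Set (Space d)} {u v : Space d → ℝ} (hH : Hhat h p < (μ : EReal)) (hμν : μ < ν)
    (hK : IsCompact K) (hKn : K.Nonempty) (hu : UpperSemicontinuous u)
    (hv : UpperSemicontinuous fun y => -v y) (hsub : IsViscositySubsolution h p μ Kᶜ u)
    (hsup : IsViscositySupersolution h p ν Kᶜ v)
    (hlim : (0 : EReal) ≤ liminf (fun y : Space d => ((v y / ‖y‖ : ℝ) : EReal))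
      (Bornology.cobounded (Space d))) :
    ∃ M : ℝ, IsLUB (range fun y => u y - v y) M ∧
      IsGreatest ((fun y => u y - v y) '' K) M := by
  obtain ⟨w, ⟨⟨L, hL⟩, hw0⟩, hwess⟩ : ∃ w ∈ sublinearLipschitz d,
      essSup (fun y : Space d => ((h (p + gradient w y) y : ℝ) : EReal)) volume < μ := by
    simpa [Hhat, iInf_lt_iff] using hH
  have hw : ∀ᵐ y, h (p + gradient w y) y ≤ μ := by
    filter_upwards [ae_lt_of_essSup_lt hwess] with y hy
    exact_mod_cast hy.le
  -- Averaging and penalization cost `η` each, leaving `μ + 2 * η < ν`.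
  set η : ℝ := (ν - μ) / 3 with hη
  have hη0 : 0 < η := by rw [hη]; linarith
  obtain ⟨W₀, DW₀, hW₀, hDW₀, hW₀w, hW₀h⟩ := exists_differentiable_subsolution hr hη0 hL hw
  obtain ⟨δ, hδ, huni⟩ := hr.uniform (‖p‖ + L + 2) (by positivity) η hη0
  set ε : ℝ := min (δ / 2) 1 with hε
  have hε0 : 0 < ε := by positivity
  have hεδ : ε < δ := (min_le_left _ _).trans_lt (by linarith)
  have hε1 : ε ≤ 1 := min_le_right _ _
  choose DJ hDJ hJ using exists_hasGradientAt_sqrt_one_add_sq (d := d)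
  set W : Space d → ℝ := fun y => W₀ y + (-ε) * √(1 + ‖y‖ ^ 2) with hWdef
  have hW : ∀ x, HasGradientAt W (DW₀ x + (-ε) • DJ x) x := fun x =>
    hasGradientAt_add (hW₀ x) (hasGradientAt_const_mul (-ε) (hJ x))
  have hWc : ∀ x, h (p + (DW₀ x + (-ε) • DJ x)) x ≤ μ + 2 * η := by
    intro x
    have hn : ‖(-ε) • DJ x‖ ≤ ε := by
      rw [norm_smul, norm_neg, Real.norm_eq_abs, abs_of_pos hε0]
      exact mul_le_of_le_one_right hε0.le (hDJ x)
    have h1 := huni (p + (DW₀ x + (-ε) • DJ x)) (by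
        rw [mem_ball_zero_iff]
        linarith [norm_add_le p (DW₀ x + (-ε) • DJ x), norm_add_le (DW₀ x) ((-ε) • DJ x), hDW₀ x])
      (p + DW₀ x) (by
        rw [mem_ball_zero_iff]
        linarith [norm_add_le p (DW₀ x), hDW₀ x]) x x
      (by
        rw [dist_eq_norm, ← add_assoc, add_sub_cancel_left]
        linarith)
      (by simpa using hδ)
    have h2 := hW₀h x
    have h3 := le_abs_self (h (p + (DW₀ x + (-ε) • DJ x)) x - h (p + DW₀ x) x)
    linarith
  have hWcont : Continuous W :=
    continuous_iff_continuousAt.2 fun x => (hW x).differentiableAt.continuousAt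
  -- Of the decay `-ε‖y‖`, `w` and `-v` use up at most `ε / 4` each.
  have hgrow : Tendsto (fun y => W y - v y) (Bornology.cobounded (Space d)) atBot := by
    have hv' : ∀ᶠ y in Bornology.cobounded (Space d), -(ε / 4) < v y / ‖y‖ := by
      have h1 : ((-(ε / 4) : ℝ) : EReal) <
          liminf (fun y : Space d => ((v y / ‖y‖ : ℝ) : EReal))
            (Bornology.cobounded (Space d)) :=
        lt_of_lt_of_le (by exact_mod_cast (by linarith : -(ε / 4) < 0)) hlim
      filter_upwards [eventually_lt_of_lt_liminf h1] with y hy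
      exact_mod_cast hy
    have hw' : ∀ᶠ y in Bornology.cobounded (Space d), w y / ‖y‖ < ε / 4 :=
      hw0.eventually (gt_mem_nhds (by positivity))
    have hb : Tendsto (fun y : Space d => (L : ℝ) + (-(ε / 2)) * ‖y‖)
        (Bornology.cobounded (Space d)) atBot :=
      tendsto_atBot_add_const_left _ _
        (tendsto_norm_cobounded_atTop.const_mul_atTop_of_neg (by linarith))
    refine tendsto_atBot_mono' _ ?_ hb
    filter_upwards [hv', hw', tendsto_norm_cobounded_atTop.eventually_gt_atTop 0] with y h1 h2 h3
    rw [lt_div_iff₀ h3] at h1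
    rw [div_lt_iff₀ h3] at h2
    have h4 : ‖y‖ ≤ √(1 + ‖y‖ ^ 2) := Real.le_sqrt_of_sq_le (by linarith)
    have h5 := (le_abs_self _).trans (hW₀w y)
    have h6 : ε * ‖y‖ ≤ ε * √(1 + ‖y‖ ^ 2) := by gcongr
    simp only [hWdef]
    linarith
  have husc : UpperSemicontinuous fun y => u y - v y := by
    simp only [sub_eq_add_neg]
    exact hu.add hv
  obtain ⟨k, hk, hkmax⟩ := (husc.upperSemicontinuousOn K).exists_isMaxOn hKn hK
  have hbound : ∀ (R : ℝ) (y : Space d), W y + softMin R (u y - W y) - v y ≤ u k - v k := by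
    intro R
    set θ : Space d → ℝ := fun y => W y + softMin R (u y - W y) with hθdef
    have hθ : UpperSemicontinuous θ := by
      have h1 : UpperSemicontinuous fun y => u y - W y := by
        simp only [sub_eq_add_neg]
        exact hu.add hWcont.neg.upperSemicontinuous
      exact hWcont.upperSemicontinuous.add
        ((continuous_softMin R).comp_upperSemicontinuous h1 (monotone_softMin R))
    have hθv : UpperSemicontinuous fun y => θ y - v y := by
      simp only [sub_eq_add_neg]
      exact hθ.add hv
    -- Truncation from above by `R` replaces any growth condition on `u`.
    have hθlim : Tendsto (fun y => θ y - v y) (Bornology.cobounded (Space d)) atBot := by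
      refine tendsto_atBot_mono (fun y => ?_) (tendsto_atBot_add_const_left _ R hgrow)
      have := softMin_lt R (u y - W y)
      simp only [hθdef]
      linarith
    obtain ⟨x₀, hx₀⟩ := exists_forall_le_of_tendsto_atBot hθv hθlim
    have hx₀K : x₀ ∈ K := by
      by_contra hnot
      exact not_isMax_sub_supersolution hr (by linarith : μ + 2 * η < ν) hK.isClosed.isOpen_compl
        hθ hv (fun φ q x hx hφ hloc => hsub.softMin_le_of_hasGradientAt hr (by linarith)
          hK.isClosed.isOpen_compl hu hW hWc R hx hφ hloc) hsup hnot hx₀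
    intro y
    refine (hx₀ y).trans ((?_ : _ ≤ u x₀ - v x₀).trans (hkmax hx₀K))
    have := softMin_le R (u x₀ - W x₀)
    simp only [hθdef]
    linarith
  have hfinal : ∀ y, u y - v y ≤ u k - v k := by
    intro y
    have h1 : Tendsto (fun R => W y + softMin R (u y - W y) - v y) atTop
        (𝓝 (W y + (u y - W y) - v y)) :=
      ((tendsto_softMin _).const_add _).sub_const _
    have h2 := le_of_tendsto' h1 fun R => hbound R y
    linarith
  refine ⟨u k - v k, ⟨?_, fun b hb => hb ⟨k, rfl⟩⟩, ⟨k, hk, rfl⟩, ?_⟩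
  · rintro _ ⟨y, rfl⟩
    exact hfinal y
  · rintro _ ⟨y, -, rfl⟩
    exact hfinal y

end HJ

end

theorem lemma2p3 {d : ℕ} {Ω : Type*} [MeasurableSpace Ω] (P : Measure Ω)
    [IsProbabilityMeasure P] (τ : HJ.Space d → Ω → Ω)
    (H : HJ.Space d → HJ.Space d → Ω → ℝ)
    (hA1 : HJ.StationaryErgodic P τ H)
    (hA2 : HJ.LevelSetConvex H)
    (hA3 : HJ.Coercive P H)
    (hA4 : HJ.BoundedEquicontinuous H) :
    ∀ᵐ ω ∂P, ∀ (p : HJ.Space d) (μ ν : ℝ) (K : Set (HJ.Space d)) (u v : HJ.Space d → ℝ),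
      HJ.Hhat (fun q y => H q y ω) p < (μ : EReal) →
      μ < ν →
      IsCompact K →
      K.Nonempty →
      UpperSemicontinuous u →
      UpperSemicontinuous (fun y => -v y) →
      HJ.IsViscositySubsolution (fun q y => H q y ω) p μ Kᶜ u →
      HJ.IsViscositySupersolution (fun q y => H q y ω) p ν Kᶜ v →
      (0 : EReal) ≤ liminf (fun y : HJ.Space d => ((v y / ‖y‖ : ℝ) : EReal))
        (Bornology.cobounded (HJ.Space d)) →
      ∃ M : ℝ, IsLUB (range fun y => u y - v y) M ∧
        IsGreatest ((fun y => u y - v y) '' K) M := by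
  filter_upwards [HJ.ae_regular hA2 hA3 hA4] with ω hω
  intro p μ ν K u v hH hμν hK hKn hu hv hsub hsup hlim
  exact hω.comparison hH hμν hK hKn hu hv hsub hsup hlim
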